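/- All formulas are first-order formulas without parameters, and equivalence is modulo a theory $T$. For $n\ge 1$, an *$n$-formula* of $T$ is a formula that is $T$-equivalent to a Boolean combination of formulas each having at most $n$ free variables. A finite set $\Phi=\{\varphi_1(\bar x),\dots,\varphi_m(\bar x)\}$ of formulas in a common tuple of variables $\bar x$ (some of which may be dummy) *witnesses that $T$ is almost $n$-ary* if every formula is $T$-equivalent to a Boolean combination of $n$-formulas and of formulas obtained from $\varphi_1,\dots,\varphi_m$ by substituting (not necessarily distinct) variables for the variables $\bar x$. The theory $T$ is *almost $n$-ary* if such a finite set exists, and ${\rm aar}(T)$ is the least $n\ge 1$ such that $T$ is almost $n$-ary ($\infty$ if there is none). If ${\rm aar}(T)=n$ is finite, the *aar-degree* ${\rm deg}_{\rm aar}(T)$ is the pair $(m,r)$, where $r$ is the least length of a tuple $\bar x$ in which some finite set of formulas witnesses that $T$ is almost $n$-ary, and $m$ is the least number of formulas in such a witnessing set with $\bar x$ of length $r$; in particular it is $(0,0)$ if every formula is an $n$-formula. A pair $(m,r)$ of natural numbers is *admissible* (for $n$) if $(m,r)=(0,0)$, or $m\ge 1$ and $r>n$. **Theorem.** For every natural number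 $n\geq 2$ and every pair $(m,r)$ that is admissible for $n$ there is a (complete, consistent) first-order theory $T$ with ${\rm aar}(T)=n$ and ${\rm deg}_{\rm aar}(T)=(m,r)$. -/

import Mathlib

universe u v

/-- `IsBoolComb S φ`: the formula `φ` is a Boolean combination of formulas belonging to `S`. -/
inductive IsBoolComb {L : FirstOrder.Language.{u, v}} {α : Type} (S : Set (L.Formula α)) :
    L.Formula α → Prop
  | basic {φ : L.Formula α} : φ ∈ S → IsBoolComb S φ
  | bot : IsBoolComb S ⊥
  | not {φ : L.Formula α} : IsBoolComb S φ → IsBoolComb S φ.not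
  | inf {φ ψ : L.Formula α} : IsBoolComb S φ → IsBoolComb S ψ → IsBoolComb S (φ ⊓ ψ)
  | sup {φ ψ : L.Formula α} : IsBoolComb S φ → IsBoolComb S ψ → IsBoolComb S (φ ⊔ ψ)

/-- The formulas, in the variables `x₀, x₁, …`, obtained from the formulas `φ(y₀, …, y_{l-1})` of
`Φ` by substituting variables (not necessarily distinct) for the free variables `y₀, …, y_{l-1}`. -/
def substInstances {L : FirstOrder.Language.{u, v}} {l : ℕ} (Φ : Set (L.Formula (Fin l))) :
    Set (L.Formula ℕ) :=
  {χ | ∃ φ ∈ Φ, ∃ g : Fin l → ℕ, χ = φ.relabel g}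

/-- `φ` is an `n`-formula of `T`: it is `T`-equivalent to a Boolean combination of formulas each
of which has (at most) `n` free variables. -/
def IsNFormula {L : FirstOrder.Language.{u, v}} (T : L.Theory) (n : ℕ) (φ : L.Formula ℕ) : Prop :=
  ∃ ψ : L.Formula ℕ,
    IsBoolComb (substInstances (Set.univ : Set (L.Formula (Fin n)))) ψ ∧ T.Iff φ ψ

/-- The finite set `Φ` of formulas `φ(y₀, …, y_{l-1})` witnesses that `T` is almost `n`-ary:
every formula is `T`-equivalent to a Boolean combination of `n`-formulas and of formulas obtained
from members of `Φ` by substitutions of free variables. -/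
def WitnessesAlmostAry {L : FirstOrder.Language.{u, v}} (T : L.Theory) (n : ℕ) {l : ℕ}
    (Φ : Finset (L.Formula (Fin l))) : Prop :=
  ∀ φ : L.Formula ℕ, ∃ ψ : L.Formula ℕ,
    IsBoolComb ({χ | IsNFormula T n χ} ∪ substInstances (Φ : Set (L.Formula (Fin l)))) ψ ∧
      T.Iff φ ψ

/-- `T` is almost `n`-ary. -/
def AlmostAry {L : FirstOrder.Language.{u, v}} (T : L.Theory) (n : ℕ) : Prop :=
  ∃ (l : ℕ) (Φ : Finset (L.Formula (Fin l))), WitnessesAlmostAry T n Φ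

/-- `aar(T)`: the least `n ≥ 1` such that `T` is almost `n`-ary, and `∞` if there is none. -/
noncomputable def aar {L : FirstOrder.Language.{u, v}} (T : L.Theory) : ℕ∞ :=
  sInf {N : ℕ∞ | ∃ n : ℕ, N = n ∧ 1 ≤ n ∧ AlmostAry T n}

/-- The aar-degree of `T` is `(m, r)`: with `n = aar(T)` finite, `r` is the least length of a
tuple of variables in which some finite set of formulas witnesses that `T` is almost `n`-ary, and
`m` is the least cardinality of such a witnessing set of formulas in `r` variables. (If `T` is
`n`-ary, the empty set is a witness, and the degree is `(0, 0)`.) -/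
def HasAarDegree {L : FirstOrder.Language.{u, v}} (T : L.Theory) (m r : ℕ) : Prop :=
  ∃ n : ℕ, aar T = n ∧
    IsLeast {l : ℕ | ∃ Φ : Finset (L.Formula (Fin l)), WitnessesAlmostAry T n Φ} r ∧
    IsLeast {k : ℕ | ∃ Φ : Finset (L.Formula (Fin r)),
      Φ.card = k ∧ WitnessesAlmostAry T n Φ} m

/-- The pairs that are admissible as aar-degrees of theories `T` with `aar(T) = n`. -/
def IsAdmissiblePair (n m r : ℕ) : Prop :=
  (m = 0 ∧ r = 0) ∨ (m ≠ 0 ∧ n < r)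

open FirstOrder FirstOrder.Language

/-! ### Boolean combinations and witnessing sets over a complete theory. -/

section General

variable {L : FirstOrder.Language.{u, v}}

/-! The theory is that of generic hypergraphs on `ℕ`: `m` of arity `r` and infinitely many of arity
`n`. Whether `s` is a hyperedge is decided by the code of its largest element, and every finite code
occurs infinitely often. This gives the extension property (`Sim.extend`), hence elimination of
quantifiers: every formula is a Boolean combination of atoms, and the `m` atoms of arity `r` form a
witnessing set.

The lower bounds compare cells, tuples on which only the full set of points can be a hyperedge.
Formulas evaluated on fewer points cannot tell two cells of the same size apart, so by
`mem_iff_of_witnesses` the witnessing formulas must. A finite set of formulas sees only finitely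
many of the `n`-ary hypergraphs, so `k < n` fails; fewer than `r` variables cannot cover an
`r`-cell; and the `2 ^ m` kinds of `r`-cell need distinct subsets of the witnessing set, so it has
at least `m` members. -/

theorem completeTheory_models_iff {α : Type} (M : Type) [L.Structure M] [Nonempty M]
    (φ : L.Formula α) : L.completeTheory M ⊨ᵇ φ ↔ ∀ v : α → M, φ.Realize v := by
  classical
  constructor
  · intro h v
    exact h.realize_formula M
  · intro h
    rw [Theory.models_formula_iff]
    intro N v
    by_contra hv
    -- A counterexample in `N` is recorded by a sentence, which transfers to `M`.
    have hN : N ⊨ φ.not.exClosure := by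
      rw [Formula.realize_exClosure]
      refine ⟨fun a => v a, ?_⟩
      refine (BoundedFormula.realize_restrictFreeVar v (by simp)).2 ?_
      exact hv
    rw [realize_iff_of_model_completeTheory M N, Formula.realize_exClosure] at hN
    obtain ⟨w, hw⟩ := hN
    obtain ⟨x⟩ := ‹Nonempty M›
    let w' : α → M := fun a => if ha : a ∈ φ.not.freeVarFinset then w ⟨a, ha⟩ else x
    have h2 := (BoundedFormula.realize_restrictFreeVar (f := id) w' fun a => by
      simp only [w', dif_pos a.2, id]).1 hw
    exact h2 (h w')

theorem completeTheory_iff_iff {α : Type} (M : Type) [L.Structure M] [Nonempty M]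
    (φ ψ : L.Formula α) :
    (L.completeTheory M).Iff φ ψ ↔ ∀ v : α → M, φ.Realize v ↔ ψ.Realize v := by
  refine (completeTheory_models_iff M (φ.iff ψ)).trans ?_
  simp only [Formula.realize_iff]

theorem IsBoolComb.realize_iff {α : Type} {M : Type} [L.Structure M] {S : Set (L.Formula α)}
    {ψ : L.Formula α} (h : IsBoolComb S ψ) {v w : α → M}
    (hS : ∀ χ ∈ S, χ.Realize v ↔ χ.Realize w) : ψ.Realize v ↔ ψ.Realize w := by
  induction h with
  | basic h => exact hS _ h
  | bot => rfl
  | not _ ih => rw [Formula.realize_not, Formula.realize_not, ih]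
  | inf _ _ ih₁ ih₂ => rw [Formula.realize_inf, Formula.realize_inf, ih₁, ih₂]
  | sup _ _ ih₁ ih₂ => rw [Formula.realize_sup, Formula.realize_sup, ih₁, ih₂]

theorem IsBoolComb.top {α : Type} {S : Set (L.Formula α)} : IsBoolComb S (Formula.not ⊥) :=
  .not .bot

/-- A property of assignments that depends only on the truth values of finitely many formulas is
defined by a Boolean combination of these formulas. -/
theorem exists_isBoolComb_of_finite {α : Type} {M : Type} [L.Structure M] {S A : Set (L.Formula α)}
    (hA : A.Finite) (hAS : A ⊆ S) (D : (α → M) → Prop)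
    (hD : ∀ v w, (∀ χ ∈ A, χ.Realize v ↔ χ.Realize w) → (D v ↔ D w)) :
    ∃ ψ : L.Formula α, IsBoolComb S ψ ∧ ∀ v, ψ.Realize v ↔ D v := by
  induction A, hA using Set.Finite.induction_on generalizing D with
  | empty =>
    by_cases h : ∃ v, D v
    · obtain ⟨v₀, hv₀⟩ := h
      refine ⟨_, IsBoolComb.top, fun v => ?_⟩
      have := (hD v₀ v (by simp)).1 hv₀
      simp [this]
    · push Not at h
      exact ⟨_, .bot, fun v => by simp [h v]⟩
  | @insert F B _ _ ih =>
    have key : ∀ P : Prop, ∃ ψ : L.Formula α, IsBoolComb S ψ ∧ ∀ v : α → M, ψ.Realize v ↔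
        ∃ w : α → M, (∀ χ ∈ B, χ.Realize v ↔ χ.Realize w) ∧ (F.Realize w ↔ P) ∧ D w := by
      intro P
      refine ih ((Set.subset_insert _ _).trans hAS) _ fun v w hvw => ?_
      refine exists_congr fun x => and_congr_left fun _ => ?_
      exact forall₂_congr fun χ hχ => by rw [hvw χ hχ]
    obtain ⟨ψ₁, h₁, h₁'⟩ := key True
    obtain ⟨ψ₀, h₀, h₀'⟩ := key False
    have hF : F ∈ S := hAS (Set.mem_insert _ _)
    refine ⟨(F ⊓ ψ₁) ⊔ (F.not ⊓ ψ₀),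
      .sup (.inf (.basic hF) h₁) (.inf (.not (.basic hF)) h₀), fun v => ?_⟩
    rw [Formula.realize_sup, Formula.realize_inf, Formula.realize_inf, Formula.realize_not,
      h₁', h₀']
    constructor
    · rintro (⟨hv, w, hB, hw, hDw⟩ | ⟨hv, w, hB, hw, hDw⟩) <;>
      · refine (hD v w ?_).2 hDw
        rintro χ (rfl | hχ)
        · tauto
        · exact hB χ hχ
    · intro hDv
      by_cases hv : F.Realize v
      · exact .inl ⟨hv, v, fun _ _ => Iff.rfl, by simpa using hv, hDv⟩
      · exact .inr ⟨hv, v, fun _ _ => Iff.rfl, by simpa using hv, hDv⟩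

theorem IsNFormula.realize_iff {M : Type} [L.Structure M] [Nonempty M] {k : ℕ}
    {χ : L.Formula ℕ} (h : IsNFormula (L.completeTheory M) k χ) {v w : ℕ → M}
    (hvw : ∀ (φ : L.Formula (Fin k)) (g : Fin k → ℕ), φ.Realize (v ∘ g) ↔ φ.Realize (w ∘ g)) :
    χ.Realize v ↔ χ.Realize w := by
  obtain ⟨ψ, hψ, hχ⟩ := h
  rw [completeTheory_iff_iff] at hχ
  rw [hχ, hχ]
  refine hψ.realize_iff ?_
  rintro _ ⟨φ, -, g, rfl⟩
  simpa only [Formula.realize_relabel] using hvw φ g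

/-- The source of all lower bounds: two assignments that agree on every instance of the building
blocks agree on every formula. -/
theorem WitnessesAlmostAry.realize_iff {M : Type} [L.Structure M] [Nonempty M] {k l : ℕ}
    {Φ : Finset (L.Formula (Fin l))} (hΦ : WitnessesAlmostAry (L.completeTheory M) k Φ)
    {v w : ℕ → M}
    (hvw : ∀ (φ : L.Formula (Fin k)) (g : Fin k → ℕ), φ.Realize (v ∘ g) ↔ φ.Realize (w ∘ g))
    (hvw' : ∀ φ ∈ Φ, ∀ g : Fin l → ℕ, φ.Realize (v ∘ g) ↔ φ.Realize (w ∘ g))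
    (φ : L.Formula ℕ) : φ.Realize v ↔ φ.Realize w := by
  obtain ⟨ψ, hψ, hφ⟩ := hΦ φ
  rw [completeTheory_iff_iff] at hφ
  rw [hφ, hφ]
  refine hψ.realize_iff ?_
  rintro χ (hχ | ⟨χ, hχ, g, rfl⟩)
  · exact IsNFormula.realize_iff hχ hvw
  · simpa only [Formula.realize_relabel] using hvw' χ hχ g

theorem isNFormula_relabel {T : L.Theory} {n : ℕ} (φ : L.Formula (Fin n)) (g : Fin n → ℕ) :
    IsNFormula T n (φ.relabel g) :=
  ⟨_, .basic ⟨φ, Set.mem_univ _, g, rfl⟩, Theory.Iff.refl _⟩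

end General

/-! ### The generic hypergraphs on `ℕ`. -/

/-- Every finite set of pairs (relation, set of points) is coded by infinitely many numbers. -/
theorem exists_coding : ∃ D : ℕ → Finset (ℕ × Finset ℕ), ∀ F, {y | D y = F}.Infinite := by
  -- The second coordinate is a free label that makes every fibre infinite.
  refine ⟨fun y => ((Denumerable.eqv (Finset (ℕ × Finset ℕ) × ℕ)).symm y).1, fun F => ?_⟩
  refine (Set.infinite_range_of_injective (f := fun k : ℕ => Denumerable.eqv (Finset (ℕ × Finset ℕ) × ℕ) (F, k)) ?_).mono ?_
  · intro a b hab
    simpa using hab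
  · rintro _ ⟨k, rfl⟩
    simp

/-- The set of pairs coded by a number. -/
noncomputable def code : ℕ → Finset (ℕ × Finset ℕ) := exists_coding.choose

theorem infinite_code_eq (F : Finset (ℕ × Finset ℕ)) : {y | code y = F}.Infinite :=
  exists_coding.choose_spec F

/-- The relational language with, for every `i : ℕ`, one relation symbol of arity `ar i`. -/
def hypLang (ar : ℕ → ℕ) : FirstOrder.Language.{0, 0} :=
  ⟨fun _ => Empty, fun k => {i : ℕ // ar i = k}⟩

/-- `Hold ar i s`: the set `s` is a hyperedge of the `i`-th hypergraph. -/
def Hold (ar : ℕ → ℕ) (i : ℕ) (s : Finset ℕ) : Prop :=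
  s.card = ar i ∧ ∃ y ∈ s, (∀ z ∈ s, z ≤ y) ∧ (i, s.erase y) ∈ code y

noncomputable instance hypStructure (ar : ℕ → ℕ) : (hypLang ar).Structure ℕ where
  funMap f := f.elim
  RelMap R x := Hold ar R.1 (Finset.univ.image x)

/-- The `i`-th relation symbol, applied to distinct variables. -/
def hypAtom {ar : ℕ → ℕ} {k : ℕ} (i : ℕ) (h : ar i = k) : (hypLang ar).Formula (Fin k) :=
  Relations.formula (L := hypLang ar) (⟨i, h⟩ : {i // ar i = k}) fun j => Term.var j

theorem realize_hypAtom {ar : ℕ → ℕ} {k : ℕ} (i : ℕ) (h : ar i = k) (v : Fin k → ℕ) :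
    (hypAtom i h).Realize v ↔ Hold ar i (Finset.univ.image v) := by
  refine Formula.realize_rel.trans ?_
  exact Iff.rfl

/-! ### Back-and-forth and elimination of quantifiers. -/

/-- Two tuples agree on equality and on the first `N` relations. -/
def Sim (ar : ℕ → ℕ) (N : ℕ) {β : Type} (f g : β → ℕ) : Prop :=
  (∀ a b, f a = f b ↔ g a = g b) ∧
    ∀ i < N, ∀ s : Finset β, Hold ar i (s.image f) ↔ Hold ar i (s.image g)

namespace Sim

variable {ar : ℕ → ℕ} {N : ℕ} {β γ : Type} {f g : β → ℕ}

theorem symm (h : Sim ar N f g) : Sim ar N g f :=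
  ⟨fun a b => (h.1 a b).symm, fun i hi s => (h.2 i hi s).symm⟩

theorem mono {K : ℕ} (h : Sim ar N f g) (hK : K ≤ N) : Sim ar K f g :=
  ⟨h.1, fun i hi => h.2 i (hi.trans_le hK)⟩

theorem comp (h : Sim ar N f g) (e : γ → β) : Sim ar N (f ∘ e) (g ∘ e) := by
  classical
  refine ⟨fun a b => h.1 _ _, fun i hi s => ?_⟩
  rw [← Finset.image_image, ← Finset.image_image]
  exact h.2 i hi _

end Sim

theorem image_eq_of_image_eq {β : Type} {f g : β → ℕ} (h : ∀ a b, f a = f b ↔ g a = g b)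
    {s t : Finset β} (hst : s.image f = t.image f) : s.image g = t.image g := by
  ext x
  have key : ∀ {s t : Finset β}, s.image f = t.image f → x ∈ s.image g → x ∈ t.image g := by
    intro s t hst hx
    obtain ⟨b, hb, rfl⟩ := Finset.mem_image.1 hx
    have : f b ∈ t.image f := hst ▸ Finset.mem_image_of_mem f hb
    obtain ⟨c, hc, hcb⟩ := Finset.mem_image.1 this
    exact Finset.mem_image.2 ⟨c, hc, (h _ _).1 hcb⟩
  exact ⟨key hst, key hst.symm⟩

theorem card_image_eq {β : Type} {f g : β → ℕ} (h : ∀ a b, f a = f b ↔ g a = g b)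
    (s : Finset β) : (s.image f).card = (s.image g).card := by
  classical
  refine Finset.card_bij' (fun x _ => if hx : ∃ b ∈ s, f b = x then g hx.choose else 0)
    (fun y _ => if hy : ∃ b ∈ s, g b = y then f hy.choose else 0) ?_ ?_ ?_ ?_
  · intro x hx
    have hx' : ∃ b ∈ s, f b = x := by simpa using hx
    rw [dif_pos hx']
    exact Finset.mem_image_of_mem _ hx'.choose_spec.1
  · intro x hx
    have hx' : ∃ b ∈ s, g b = x := by simpa using hx
    rw [dif_pos hx']
    exact Finset.mem_image_of_mem _ hx'.choose_spec.1
  · intro x hx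
    have hx' : ∃ b ∈ s, f b = x := by simpa using hx
    have hy : ∃ b ∈ s, g b = g hx'.choose := ⟨_, hx'.choose_spec.1, rfl⟩
    simp only [dif_pos hx', dif_pos hy]
    rw [(h _ _).2 hy.choose_spec.2, hx'.choose_spec.2]
  · intro x hx
    have hx' : ∃ b ∈ s, g b = x := by simpa using hx
    have hy : ∃ b ∈ s, f b = f hx'.choose := ⟨_, hx'.choose_spec.1, rfl⟩
    simp only [dif_pos hx', dif_pos hy]
    rw [(h _ _).1 hy.choose_spec.2, hx'.choose_spec.2]

theorem hold_insert_iff {ar : ℕ → ℕ} {i y : ℕ} {s : Finset ℕ} (h : ∀ z ∈ s, z < y) :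
    Hold ar i (insert y s) ↔ s.card + 1 = ar i ∧ (i, s) ∈ code y := by
  have hy : y ∉ s := fun hy => lt_irrefl _ (h y hy)
  unfold Hold
  rw [Finset.card_insert_of_notMem hy]
  refine and_congr_right fun _ => ⟨?_, fun hc => ?_⟩
  · rintro ⟨z, hz, hmax, hc⟩
    rcases Finset.mem_insert.1 hz with rfl | hz
    · rwa [Finset.erase_insert hy] at hc
    · exact absurd (hmax y (Finset.mem_insert_self _ _)) (not_le.2 (h z hz))
  · refine ⟨y, Finset.mem_insert_self _ _, fun z hz => ?_, by rwa [Finset.erase_insert hy]⟩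
    rcases Finset.mem_insert.1 hz with rfl | hz
    · exact le_rfl
    · exact (h z hz).le

/-- The extension property of the structure. -/
theorem Sim.extend {ar : ℕ → ℕ} {N : ℕ} {β : Type} [Finite β] {f g : β → ℕ} (h : Sim ar N f g)
    (y : ℕ) : ∃ y' : ℕ, Sim ar N (fun o : Option β => o.elim y f) (fun o => o.elim y' g) := by
  classical
  have := Fintype.ofFinite β
  by_cases hy : ∃ b, f b = y
  · obtain ⟨b, rfl⟩ := hy
    refine ⟨g b, ?_⟩
    have h₂ := h.comp (fun o : Option β => o.getD b)
    convert h₂ using 1 <;> ext o <;> cases o <;> rfl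
  · push Not at hy
    -- The code that a new point above all values of `g` must have in order to imitate `y` over `f`.
    let F : Finset (ℕ × Finset ℕ) :=
      ((Finset.range N ×ˢ (Finset.univ : Finset (Finset β))).filter
        fun p => Hold ar p.1 (insert y (p.2.image f))).image fun p => (p.1, p.2.image g)
    obtain ⟨y', hF, hy'⟩ := (infinite_code_eq F).exists_gt (Finset.univ.sup g)
    have hlt : ∀ b, g b < y' := fun b => (Finset.le_sup (Finset.mem_univ b)).trans_lt hy'
    have hF' : code y' = F := hF
    have hins : ∀ i < N, ∀ s : Finset β,
        Hold ar i (insert y (s.image f)) ↔ Hold ar i (insert y' (s.image g)) := by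
      intro i hi s
      rw [hold_insert_iff (s := s.image g) (by simpa using fun b _ => hlt b), hF']
      constructor
      · intro hs
        refine ⟨?_, Finset.mem_image.2 ⟨(i, s), by simpa [hi] using hs, rfl⟩⟩
        rw [← hs.1, Finset.card_insert_of_notMem (by simpa using fun b _ => hy b),
          card_image_eq h.1]
      · rintro ⟨-, hs⟩
        obtain ⟨⟨j, t⟩, ht, hjt⟩ := Finset.mem_image.1 hs
        obtain ⟨rfl, hts⟩ := Prod.mk.inj hjt
        rw [← image_eq_of_image_eq (fun a b => (h.1 a b).symm) hts]
        exact (Finset.mem_filter.1 ht).2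
    refine ⟨y', ?_, fun i hi s => ?_⟩
    · rintro (_ | a) (_ | b)
      · simp
      · simpa [(hlt b).ne'] using (hy b).symm
      · simpa [(hlt a).ne] using hy a
      · exact h.1 a b
    · have himg : ∀ (x : ℕ) (k : β → ℕ), s.image (fun o : Option β => o.elim x k) =
          if none ∈ s then insert x (s.eraseNone.image k) else s.eraseNone.image k := by
        intro x k
        ext z
        split_ifs with hs
        · simp only [Finset.mem_image, Finset.mem_insert, Finset.mem_eraseNone, Option.exists,
            Option.elim, hs, true_and, eq_comm]
        · simp only [Finset.mem_image, Finset.mem_eraseNone, Option.exists,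
            Option.elim, hs, false_and, false_or]
      rw [himg, himg]
      split_ifs
      · exact hins i hi _
      · exact h.2 i hi _

theorem hypLang_term_eq_var {ar : ℕ → ℕ} {α : Type} (t : (hypLang ar).Term α) :
    ∃ a, t = Term.var a := by
  cases t with
  | var a => exact ⟨a, rfl⟩
  | func f _ => exact f.elim

/-- The truth value of a formula depends only on equality and on finitely many relations. -/
theorem exists_sim_realize_iff {ar : ℕ → ℕ} {α : Type} [Finite α] {k : ℕ}
    (φ : (hypLang ar).BoundedFormula α k) :
    ∃ N, ∀ (v w : α → ℕ) (x z : Fin k → ℕ), Sim ar N (Sum.elim v x) (Sum.elim w z) →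
      (φ.Realize v x ↔ φ.Realize w z) := by
  induction φ with
  | falsum => exact ⟨0, fun _ _ _ _ _ => Iff.rfl⟩
  | equal t₁ t₂ =>
    obtain ⟨a, rfl⟩ := hypLang_term_eq_var t₁
    obtain ⟨b, rfl⟩ := hypLang_term_eq_var t₂
    exact ⟨0, fun v w x z h => h.1 a b⟩
  | @rel k l R ts =>
    choose e he using fun i => hypLang_term_eq_var (ts i)
    obtain rfl : ts = fun i => Term.var (e i) := funext he
    refine ⟨R.1 + 1, fun v w x z h => ?_⟩
    classical
    have := h.2 R.1 (Nat.lt_succ_self _) (Finset.univ.image e)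
    rw [Finset.image_image, Finset.image_image] at this
    exact this
  | imp φ ψ ih₁ ih₂ =>
    obtain ⟨N₁, h₁⟩ := ih₁
    obtain ⟨N₂, h₂⟩ := ih₂
    refine ⟨max N₁ N₂, fun v w x z h => ?_⟩
    rw [BoundedFormula.realize_imp, BoundedFormula.realize_imp,
      h₁ v w x z (h.mono (le_max_left _ _)), h₂ v w x z (h.mono (le_max_right _ _))]
  | @all k φ ih =>
    obtain ⟨N, hN⟩ := ih
    -- One direction suffices, since `Sim` is symmetric.
    have key : ∀ (v w : α → ℕ) (x z : Fin k → ℕ), Sim ar N (Sum.elim v x) (Sum.elim w z) →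
        φ.all.Realize w z → φ.all.Realize v x := by
      intro v w x z h hw y
      obtain ⟨y', hy'⟩ := h.extend y
      refine (hN v w (Fin.snoc x y) (Fin.snoc z y') ?_).2 (hw y')
      let e : α ⊕ Fin (k + 1) → Option (α ⊕ Fin k) :=
        Sum.elim (fun a => some (.inl a)) fun j =>
          Fin.lastCases (motive := fun _ => Option (α ⊕ Fin k)) none (fun j => some (.inr j)) j
      convert hy'.comp e using 1
      · ext (a | j)
        · rfl
        · cases j using Fin.lastCases <;> simp [e]
      · ext (a | j)
        · rfl
        · cases j using Fin.lastCases <;> simp [e]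
    exact ⟨N, fun v w x z h => ⟨key w v z x h.symm, key v w x z h⟩⟩

theorem exists_sim_formula_realize_iff {ar : ℕ → ℕ} {α : Type} [Finite α]
    (φ : (hypLang ar).Formula α) :
    ∃ N, ∀ v w : α → ℕ, Sim ar N v w → (φ.Realize v ↔ φ.Realize w) := by
  obtain ⟨N, hN⟩ := exists_sim_realize_iff φ
  refine ⟨N, fun v w h => hN v w _ _ ?_⟩
  convert h.comp (Sum.elim id (Fin.elim0 : Fin 0 → α)) using 1 <;>
  · ext (a | j)
    · rfl
    · exact j.elim0

/-- Every formula is equivalent to a Boolean combination of any set of formulas that contains the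
atomic formulas. -/
theorem exists_isBoolComb_of_atoms_mem {ar : ℕ → ℕ} {S : Set ((hypLang ar).Formula ℕ)}
    (hEq : ∀ a b : ℕ, Term.equal (Term.var a) (Term.var b) ∈ S)
    (hRel : ∀ (i : ℕ) (h : Fin (ar i) → ℕ), (hypAtom i rfl).relabel h ∈ S)
    (φ : (hypLang ar).Formula ℕ) :
    ∃ ψ, IsBoolComb S ψ ∧ ((hypLang ar).completeTheory ℕ).Iff φ ψ := by
  classical
  let V : Finset ℕ := φ.freeVarFinset
  obtain ⟨N, hN⟩ := exists_sim_formula_realize_iff (φ.restrictFreeVar id : (hypLang ar).Formula V)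
  have hr : ∀ v : ℕ → ℕ, Formula.Realize (φ.restrictFreeVar id : (hypLang ar).Formula V)
      (fun a => v a) ↔ φ.Realize v := fun v =>
    BoundedFormula.realize_restrictFreeVar v (by simp)
  let A₁ : Set ((hypLang ar).Formula ℕ) :=
    Set.range fun p : V × V => Term.equal (Term.var (p.1 : ℕ)) (Term.var (p.2 : ℕ))
  let A₂ : Set ((hypLang ar).Formula ℕ) :=
    Set.range fun p : (i : Fin N) × (Fin (ar i) → V) =>
      (hypAtom (ar := ar) p.1 rfl).relabel fun j => (p.2 j : ℕ)
  obtain ⟨ψ, hψ, hψφ⟩ := exists_isBoolComb_of_finite (M := ℕ) (S := S) (A := A₁ ∪ A₂)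
    ((Set.finite_range _).union (Set.finite_range _))
    (by
      rintro _ (⟨p, rfl⟩ | ⟨p, rfl⟩)
      · exact hEq _ _
      · exact hRel _ _) (fun v => φ.Realize v) (by
    intro v w hvw
    simp only [← hr]
    have hker : ∀ a b : V, v a = v b ↔ w a = w b := fun a b => by
      have := hvw _ (.inl ⟨(a, b), rfl⟩)
      simpa [Formula.realize_equal] using this
    have hatom : ∀ i < N, ∀ h : Fin (ar i) → V,
        Hold ar i (Finset.univ.image fun j => v (h j)) ↔
          Hold ar i (Finset.univ.image fun j => w (h j)) := fun i hi h => by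
      have := hvw _ (.inr ⟨⟨⟨i, hi⟩, h⟩, rfl⟩)
      rw [Formula.realize_relabel, Formula.realize_relabel, realize_hypAtom, realize_hypAtom] at this
      exact this
    refine hN _ _ ⟨hker, fun i hi s => ?_⟩
    have hcard := card_image_eq hker s
    -- An image of the right size is enumerated by an atom's variables; any other size rules out a
    -- hyperedge on both sides.
    by_cases hs : (s.image fun a : V => v a).card = ar i
    · let e := Finset.equivFinOfCardEq hs
      have hex : ∀ j : Fin (ar i), ∃ a : V, v a = e.symm j := fun j => by
        obtain ⟨a, -, ha⟩ := Finset.mem_image.1 (e.symm j).2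
        exact ⟨a, ha⟩
      choose h hh using hex
      have himg : (s.image fun a : V => v a) = (Finset.univ.image h).image fun a : V => v a := by
        ext x
        constructor
        · intro hx
          refine Finset.mem_image.2 ⟨h (e ⟨x, hx⟩), by simp, by simp [hh]⟩
        · intro hx
          obtain ⟨a, ha, rfl⟩ := Finset.mem_image.1 hx
          obtain ⟨j, -, rfl⟩ := Finset.mem_image.1 ha
          rw [hh]
          exact (e.symm j).2
      rw [image_eq_of_image_eq hker himg, himg, Finset.image_image, Finset.image_image]
      exact hatom i hi h
    · exact iff_of_false (fun h => hs h.1) (fun h => hs (hcard.trans h.1)))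
  exact ⟨ψ, hψ, (completeTheory_iff_iff _ _ _).2 fun v => (hψφ v).symm⟩

/-! ### Cells. -/

/-- A `k`-tuple of distinct points is an `F`-cell if no proper subset of it is a hyperedge, and the
whole tuple is a hyperedge of exactly those `k`-hypergraphs whose index belongs to `F`. -/
def IsCell (ar : ℕ → ℕ) {k : ℕ} (F : Finset ℕ) (a : Fin k → ℕ) : Prop :=
  Function.Injective a ∧
    ∀ (i : ℕ) (s : Finset (Fin k)), Hold ar i (s.image a) ↔ s = Finset.univ ∧ i ∈ F ∧ ar i = k

/-- Take `k` points with empty code, so that none is the maximum of a hyperedge, and a larger point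
coding exactly the pairs of an index in `F` with these `k` points. -/
theorem exists_isCell {ar : ℕ → ℕ} (k : ℕ) (F : Finset ℕ) :
    ∃ a : Fin (k + 1) → ℕ, IsCell ar F a := by
  classical
  obtain ⟨B, hB, hBk⟩ := (infinite_code_eq ∅).exists_subset_card_eq k
  obtain ⟨y, hy, hyB⟩ := (infinite_code_eq (F.image fun i => (i, B))).exists_gt (B.sup id)
  have hlt : ∀ z ∈ B, z < y := fun z hz => (Finset.le_sup (f := id) hz).trans_lt hyB
  have hyB' : y ∉ B := fun h => lt_irrefl _ (hlt y h)
  have hA : (insert y B).card = k + 1 := by rw [Finset.card_insert_of_notMem hyB', hBk]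
  let e := (Finset.equivFinOfCardEq hA).symm
  have hinj : Function.Injective fun j => (e j : ℕ) :=
    Subtype.val_injective.comp e.injective
  have himg : Finset.univ.image (fun j => (e j : ℕ)) = insert y B := by
    ext x
    constructor
    · intro hx
      obtain ⟨j, -, rfl⟩ := Finset.mem_image.1 hx
      exact (e j).2
    · exact fun hx => Finset.mem_image.2 ⟨e.symm ⟨x, hx⟩, Finset.mem_univ _, by simp⟩
  have hcode : ∀ i t, (i, t) ∈ code y ↔ i ∈ F ∧ t = B := by
    intro i t
    rw [show code y = _ from hy]
    simp [eq_comm]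
  refine ⟨fun j => e j, hinj, fun i s => ?_⟩
  constructor
  · rintro ⟨hc, z, hz, hmax, hzc⟩
    have hzA : z ∈ insert y B := himg ▸ Finset.image_subset_image (Finset.subset_univ s) hz
    rcases Finset.mem_insert.1 hzA with rfl | hzB
    · obtain ⟨hi, hs⟩ := (hcode _ _).1 hzc
      have hs' : s.image (fun j => (e j : ℕ)) = insert z B := by
        have := Finset.insert_erase hz
        rw [hs] at this
        exact this.symm
      refine ⟨Finset.image_injective hinj (hs'.trans himg.symm), hi, ?_⟩
      rw [← hc, hs', hA]
    · have : code z = ∅ := hB hzB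
      simp [this] at hzc
  · rintro ⟨rfl, hi, hik⟩
    rw [himg, hold_insert_iff hlt]
    exact ⟨by rw [hBk, hik], (hcode _ _).2 ⟨hi, rfl⟩⟩

namespace IsCell

variable {ar : ℕ → ℕ} {k l N : ℕ} {F G : Finset ℕ} {a b : Fin k → ℕ}

theorem sim_comp (ha : IsCell ar F a) (hb : IsCell ar G b) (h : ∀ i < N, i ∈ F ↔ i ∈ G)
    (g : Fin l → Fin k) : Sim ar N (a ∘ g) (b ∘ g) := by
  refine Sim.comp ⟨fun x y => by rw [ha.1.eq_iff, hb.1.eq_iff], fun i hi s => ?_⟩ g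
  rw [ha.2, hb.2, h i hi]

theorem sim_comp_of_not_surjective (ha : IsCell ar F a) (hb : IsCell ar G b)
    {g : Fin l → Fin k} (hg : ¬ Function.Surjective g) : Sim ar N (a ∘ g) (b ∘ g) := by
  refine ⟨fun x y => by simp only [Function.comp_apply, ha.1.eq_iff, hb.1.eq_iff],
    fun i _ s => ?_⟩
  rw [← Finset.image_image, ← Finset.image_image, ha.2, hb.2]
  have : s.image g ≠ Finset.univ := by
    intro hs
    refine hg fun x => ?_
    obtain ⟨j, -, hj⟩ := Finset.mem_image.1 (hs ▸ Finset.mem_univ x)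
    exact ⟨j, hj⟩
  simp [this]

theorem sim_comp_of_bijective (ha : IsCell ar F a) {g : Fin k → Fin k}
    (hg : Function.Bijective g) : Sim ar N (a ∘ g) a := by
  refine ⟨fun x y => by simp only [Function.comp_apply, ha.1.eq_iff, hg.1.eq_iff],
    fun i _ s => ?_⟩
  rw [← Finset.image_image, ha.2, ha.2]
  refine and_congr_left fun _ => ⟨fun hs => ?_, ?_⟩
  · refine Finset.image_injective hg.1 (hs.trans ?_)
    exact (Finset.image_univ_of_surjective hg.2).symm
  · rintro rfl
    exact Finset.image_univ_of_surjective hg.2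

theorem realize_iff_of_not_surjective (ha : IsCell ar F a) (hb : IsCell ar G b)
    {g : Fin l → Fin k} (hg : ¬ Function.Surjective g) (φ : (hypLang ar).Formula (Fin l)) :
    φ.Realize (a ∘ g) ↔ φ.Realize (b ∘ g) := by
  obtain ⟨N, hN⟩ := exists_sim_formula_realize_iff φ
  exact hN _ _ (ha.sim_comp_of_not_surjective hb hg)

theorem realize_iff_of_bijective (ha : IsCell ar F a) {g : Fin k → Fin k}
    (hg : Function.Bijective g) (φ : (hypLang ar).Formula (Fin k)) :
    φ.Realize (a ∘ g) ↔ φ.Realize a := by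
  obtain ⟨N, hN⟩ := exists_sim_formula_realize_iff φ
  exact hN _ _ (ha.sim_comp_of_bijective hg)

/-- Cells that satisfy the same substitution instances of `k`-formulas and of a witnessing set are
cells for the same hypergraphs. -/
theorem mem_iff_of_witnesses {k l n i : ℕ} {a b : Fin (k + 1) → ℕ} (ha : IsCell ar F a)
    (hb : IsCell ar G b) (hi : ar i = k + 1) (hn : n < k + 1)
    {Φ : Finset ((hypLang ar).Formula (Fin l))}
    (hΦ : WitnessesAlmostAry ((hypLang ar).completeTheory ℕ) n Φ)
    (hab : ∀ φ ∈ Φ, ∀ g : Fin l → Fin (k + 1), φ.Realize (a ∘ g) ↔ φ.Realize (b ∘ g)) :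
    i ∈ F ↔ i ∈ G := by
  -- `Fin.ofNat` turns a cell into an assignment of all variables; a substitution of `n < k + 1`
  -- variables then misses a point of it.
  have h := hΦ.realize_iff (v := a ∘ Fin.ofNat (k + 1)) (w := b ∘ Fin.ofNat (k + 1))
    (fun φ g => ha.realize_iff_of_not_surjective hb (g := Fin.ofNat (k + 1) ∘ g)
      (fun hs => by
        have := Fintype.card_le_of_surjective _ hs
        simp only [Fintype.card_fin] at this
        omega) φ)
    (fun φ hφ g => hab φ hφ (Fin.ofNat (k + 1) ∘ g)) ((hypAtom i hi).relabel Fin.val)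
  have hval : Fin.ofNat (k + 1) ∘ Fin.val = id := by
    ext j
    simp
  rw [Formula.realize_relabel, Formula.realize_relabel, Function.comp_assoc, Function.comp_assoc,
    hval, Function.comp_id, Function.comp_id, realize_hypAtom, realize_hypAtom, ha.2, hb.2] at h
  simpa [hi] using h

end IsCell

/-! ### Lower bounds for the arity and the degree. -/

/-- If infinitely many relations have arity `n`, then the structure is not almost `k`-ary for
any `k < n`. -/
theorem not_almostAry_of_lt {ar : ℕ → ℕ} {k n : ℕ} (har : {i | ar i = n}.Infinite) (hk : k < n) :
    ¬ AlmostAry ((hypLang ar).completeTheory ℕ) k := by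
  rintro ⟨l, Φ, hΦ⟩
  obtain ⟨n, rfl⟩ : ∃ n', n = n' + 1 := ⟨n - 1, by omega⟩
  choose N hN using fun φ : (hypLang ar).Formula (Fin l) => exists_sim_formula_realize_iff φ
  -- A relation of arity `n` too late to affect any formula of `Φ`.
  obtain ⟨i, hi, hiN⟩ := har.exists_gt (Φ.sup N)
  obtain ⟨a, ha⟩ := exists_isCell (ar := ar) n {i}
  obtain ⟨b, hb⟩ := exists_isCell (ar := ar) n ∅
  have := ha.mem_iff_of_witnesses hb hi hk hΦ fun φ hφ g => hN φ _ _ <|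
    ha.sim_comp hb (fun j hj => by
      have : N φ ≤ Φ.sup N := Finset.le_sup hφ
      have : j ≠ i := by omega
      simp [this]) g
  simp at this

/-- A witnessing set needs at least as many variables as the arity of any relation of arity
greater than `n`. -/
theorem le_of_witnesses {ar : ℕ → ℕ} {i l n r : ℕ} (hi : ar i = r) (hn : n < r)
    {Φ : Finset ((hypLang ar).Formula (Fin l))}
    (hΦ : WitnessesAlmostAry ((hypLang ar).completeTheory ℕ) n Φ) : r ≤ l := by
  by_contra! hl
  obtain ⟨r, rfl⟩ : ∃ r', r = r' + 1 := ⟨r - 1, by omega⟩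
  obtain ⟨a, ha⟩ := exists_isCell (ar := ar) r {i}
  obtain ⟨b, hb⟩ := exists_isCell (ar := ar) r ∅
  have := ha.mem_iff_of_witnesses hb hi hn hΦ fun φ hφ g =>
    ha.realize_iff_of_not_surjective hb (fun hs => by
      have := Fintype.card_le_of_surjective _ hs
      simp only [Fintype.card_fin] at this
      omega) φ
  simp at this

/-- A witnessing set in `r` variables has at least as many members as there are relations of
arity `r`, where `n < r`. -/
theorem card_le_of_witnesses {ar : ℕ → ℕ} {n r : ℕ} {I : Finset ℕ} (hI : ∀ i ∈ I, ar i = r)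
    (hn : n < r) {Φ : Finset ((hypLang ar).Formula (Fin r))}
    (hΦ : WitnessesAlmostAry ((hypLang ar).completeTheory ℕ) n Φ) : I.card ≤ Φ.card := by
  classical
  obtain ⟨r, rfl⟩ : ∃ r', r = r' + 1 := ⟨r - 1, by omega⟩
  choose a ha using exists_isCell (ar := ar) r
  have hmaps : ∀ F ∈ I.powerset, Φ.filter (fun φ => φ.Realize (a F)) ∈ Φ.powerset :=
    fun F _ => Finset.mem_powerset.2 (Finset.filter_subset _ _)
  have hinj : Set.InjOn (fun F => Φ.filter fun φ => φ.Realize (a F)) (I.powerset : Set _) := by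
    intro F hF G hG hFG
    have hF' : F ⊆ I := Finset.mem_powerset.1 hF
    have hG' : G ⊆ I := Finset.mem_powerset.1 hG
    have key : ∀ i ∈ I, i ∈ F ↔ i ∈ G := fun i hi =>
      (ha F).mem_iff_of_witnesses (ha G) (hI i hi) hn hΦ fun φ hφ g => by
        by_cases hg : Function.Surjective g
        · have hg' := Finite.surjective_iff_bijective.1 hg
          rw [(ha F).realize_iff_of_bijective hg', (ha G).realize_iff_of_bijective hg']
          have := Finset.ext_iff.1 hFG φ
          simpa [hφ] using this
        · exact (ha F).realize_iff_of_not_surjective (ha G) hg φ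
    ext i
    exact ⟨fun h => (key i (hF' h)).1 h, fun h => (key i (hG' h)).2 h⟩
  have := Finset.card_le_card_of_injOn _ hmaps hinj
  rw [Finset.card_powerset, Finset.card_powerset] at this
  exact (Nat.pow_le_pow_iff_right (by norm_num)).1 this

/-! ### The upper bound and the theorem. -/

/-- If every relation of arity different from `n` has its atomic formula in `Φ`, then `Φ` witnesses
that the structure is almost `n`-ary. -/
theorem witnessesAlmostAry_of_atoms {ar : ℕ → ℕ} {n r : ℕ} (hn : 2 ≤ n)
    {Φ : Finset ((hypLang ar).Formula (Fin r))}
    (h : ∀ i, ar i = n ∨ ∃ hi : ar i = r, hypAtom i hi ∈ Φ) :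
    WitnessesAlmostAry ((hypLang ar).completeTheory ℕ) n Φ := by
  refine exists_isBoolComb_of_atoms_mem (fun a b => .inl ?_) fun i g => ?_
  -- Equality has two variables; this is where `2 ≤ n` enters.
  · exact isNFormula_relabel
      (Term.equal (Term.var (⟨0, by omega⟩ : Fin n)) (Term.var (⟨1, by omega⟩ : Fin n)))
      (fun j => if (j : ℕ) = 0 then a else b)
  · rcases h i with rfl | ⟨rfl, hi⟩
    · exact .inl (isNFormula_relabel _ _)
    · exact .inr ⟨_, hi, g, rfl⟩

theorem aar_eq {L : FirstOrder.Language.{u, v}} {T : L.Theory} {n : ℕ} (hn : 1 ≤ n)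
    (h : AlmostAry T n) (h' : ∀ k < n, ¬ AlmostAry T k) : aar T = n := by
  refine le_antisymm (sInf_le ⟨n, rfl, hn, h⟩) (le_sInf ?_)
  rintro _ ⟨k, rfl, -, hk⟩
  by_contra! hlt
  exact h' k (by exact_mod_cast hlt) hk

theorem hypAtom_injective {ar : ℕ → ℕ} {k i j : ℕ} {hi : ar i = k} {hj : ar j = k}
    (h : hypAtom i hi = hypAtom j hj) : i = j := by
  injection h with _ _ h
  exact congrArg Subtype.val h

theorem mainTheorem4 (n : ℕ) (hn : 2 ≤ n) (m r : ℕ) (hmr : IsAdmissiblePair n m r) :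
    ∃ (L : FirstOrder.Language.{0, 0}) (T : L.Theory),
      T.IsComplete ∧ aar T = (n : ℕ∞) ∧ HasAarDegree T m r := by
  classical
  -- For the pair `(0, 0)` all relations are `n`-ary and `Φ` below is empty.
  let ar : ℕ → ℕ := fun i => if i < m then r else n
  have har : ∀ i < m, ar i = r := fun i hi => if_pos hi
  have har' : ∀ i, m ≤ i → ar i = n := fun i hi => if_neg (by omega)
  let Φ : Finset ((hypLang ar).Formula (Fin r)) :=
    Finset.univ.image fun j : Fin m => hypAtom (ar := ar) j (har j j.2)
  have hΦcard : Φ.card = m := by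
    rw [Finset.card_image_of_injective _ fun i j hij => Fin.ext (hypAtom_injective hij)]
    simp
  have hΦ : WitnessesAlmostAry ((hypLang ar).completeTheory ℕ) n Φ :=
    witnessesAlmostAry_of_atoms hn fun i => by
      by_cases hi : i < m
      · exact .inr ⟨har i hi, Finset.mem_image.2 ⟨⟨i, hi⟩, Finset.mem_univ _, rfl⟩⟩
      · exact .inl (har' i (by omega))
  have haar : aar ((hypLang ar).completeTheory ℕ) = n :=
    aar_eq (by omega) ⟨r, Φ, hΦ⟩ fun k hk =>
      not_almostAry_of_lt ((Set.Ici_infinite m).mono fun i hi => har' i hi) hk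
  refine ⟨hypLang ar, (hypLang ar).completeTheory ℕ, completeTheory.isComplete _ _, haar,
    n, haar, ⟨⟨Φ, hΦ⟩, ?_⟩, ⟨⟨Φ, hΦcard, hΦ⟩, ?_⟩⟩
  · rintro l ⟨Ψ, hΨ⟩
    rcases hmr with ⟨-, rfl⟩ | ⟨hm, hr⟩
    · exact Nat.zero_le _
    · exact le_of_witnesses (har 0 (by omega)) hr hΨ
  · rintro _ ⟨Ψ, rfl, hΨ⟩
    rcases hmr with ⟨rfl, -⟩ | ⟨hm, hr⟩
    · exact Nat.zero_le _
    · simpa using card_le_of_witnesses (I := Finset.range m)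
        (fun i hi => har i (Finset.mem_range.1 hi)) hr hΨ
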